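/- All rings are commutative with $1$; a local ring is a Noetherian ring with exactly one maximal ideal. For a local ring $R$ with maximal ideal $\mathfrak m$, $\widehat R$ denotes its $\mathfrak m$-adic completion, and $\operatorname{Min}(R)$ its set of minimal prime ideals. **The Gluing Theorem.** Let $B$ be a reduced local ring with maximal ideal $M$ that contains $\mathbb{Q}$, and suppose that $B/M$ is uncountable and $|B| = |B/M|$. Let $m \ge 1$ and let $\operatorname{Min}(B)$ be partitioned into $m$ (nonempty, pairwise disjoint) subcollections $C_1,\dots,C_m$. Then there is a subring $S \subseteq B$ that is a reduced local ring with maximal ideal $S\cap M$ such that 1. $S$ contains $\mathbb{Q}$; 2. $\widehat S = \widehat B$, that is, there is a ring isomorphism $\widehat S \to \widehat B$ that is compatible with the inclusion $S \subseteq B$ and the canonical maps $S \to \widehat S$ and $B \to \widehat B$; 3. $S/(S\cap M)$ is uncountable and $|S| = |S/(S\cap M)|$; 4. for $Q, Q' \in \operatorname{Min}(B)$, one has $Q\cap S = Q'\cap S$ if and only if there is an $i \in \{1,\dots,m\}$ with $Q \in C_i$ and $Q' \in C_i$; 5. the map $f : \operatorname{Spec}(B) \to \operatorname{Spec}(S)$,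 $f(P) = S\cap P$, is onto, and $f(P)B = P$ for every prime ideal $P$ of $B$ of positive height. In particular, if $P$ and $P'$ are prime ideals of $B$ of positive height, then $f(P)$ has positive height, and $f(P) = f(P')$ implies $P = P'$. -/

import Mathlib

open IsLocalRing

/-! Inside `B` one builds a domain `A` that meets every minimal prime only in `0`, yet meets every
coset `b + rB` with `r` outside all minimal primes. A transfinite recursion over the pairs `(b, r)`
adds one generator from each such coset, transcendental modulo every minimal prime over the earlier
generators. This is possible because fewer than `|B/M|` residue classes of the multiplier are bad.

The glued ring `S` consists of the elements that, modulo the intersection of each class `C i`, equal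
a fraction over `A`. One fraction serves a whole class and `A` embeds in every `B ⧸ Q`, so vanishing
at one prime of a class forces vanishing at all of them; distinct classes get independent fractions.

The coset property makes every ideal of `S` contracted from `B` (`comap_map_locallyFractions`).
This, with the density of `S` in `B`, gives that `S` is Noetherian and local, the completion, and
surjectivity on spectra. -/

/-! ### Transfinite construction of the small domain. -/

open Cardinal in
/-- In an uncountable domain, the elements algebraic over a small subalgebra are few. -/
theorem mk_isAlgebraic_adjoin_lt {D : Type*} [CommRing D] [IsDomain D] [Algebra ℚ D]
    {κ : Cardinal} (hκ : ℵ₀ < κ) {T : Set D} (hT : #T < κ) :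
    #{x : D // IsAlgebraic (Algebra.adjoin ℚ T) x} < κ := by
  refine (Algebraic.cardinalMk_le_max _ _).trans_lt (max_lt ?_ hκ)
  have h := Algebra.lift_cardinalMk_adjoin_le ℚ T
  simp only [lift_id'.{0}] at h
  refine h.trans_lt (max_lt (max_lt ?_ hT) hκ)
  simpa using hκ

open Cardinal in
/-- A coset `b + rB`, with `r` outside finitely many primes, contains an element that is
transcendental modulo each of them over the subalgebra generated by a small set. -/
theorem exists_transcendental_mod {B : Type*} [CommRing B] [IsLocalRing B] [Algebra ℚ B]
    (hunc : ℵ₀ < #(B ⧸ maximalIdeal B)) {F : Set (Ideal B)} (hF : F.Finite)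
    (hprime : ∀ Q ∈ F, Q.IsPrime) {T : Set B} (hT : #T < #(B ⧸ maximalIdeal B))
    (b : B) {r : B} (hr : ∀ Q ∈ F, r ∉ Q) :
    ∃ t : B, ∀ Q ∈ F, Transcendental (Algebra.adjoin ℚ (Ideal.Quotient.mk Q '' T))
      (Ideal.Quotient.mk Q (b + r * t)) := by
  set bad : Ideal B → Set (B ⧸ maximalIdeal B) := fun Q ↦
    {x | ∃ t, Ideal.Quotient.mk _ t = x ∧ IsAlgebraic
      (Algebra.adjoin ℚ (Ideal.Quotient.mk Q '' T)) (Ideal.Quotient.mk Q (b + r * t))}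
  have hlt : ∀ Q ∈ F, #(bad Q) < #(B ⧸ maximalIdeal B) := by
    intro Q hQ
    have := hprime Q hQ
    refine lt_of_le_of_lt ?_ (mk_isAlgebraic_adjoin_lt hunc (mk_image_le.trans_lt hT)
      (T := Ideal.Quotient.mk Q '' T))
    have hch : ∀ x : bad Q, ∃ t, Ideal.Quotient.mk _ t = x.1 ∧ IsAlgebraic
      (Algebra.adjoin ℚ (Ideal.Quotient.mk Q '' T)) (Ideal.Quotient.mk Q (b + r * t)) :=
      fun x ↦ x.2
    choose t ht ht' using hch
    -- If two lifts give the same value modulo `Q`, then `r` times their difference lies in `Q`, so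
    -- the difference lies in `Q ≤ M` and the residues agree.
    refine mk_le_of_injective (f := fun x ↦ ⟨_, ht' x⟩) fun x y hxy ↦ ?_
    have h : r * (t x - t y) ∈ Q := by
      have := Ideal.Quotient.eq.1 (congrArg Subtype.val hxy)
      convert this using 1
      ring
    rw [Subtype.ext_iff, ← ht x, ← ht y, Ideal.Quotient.eq]
    exact le_maximalIdeal (hprime Q hQ).ne_top (((hprime Q hQ).mem_or_mem h).resolve_left (hr Q hQ))
  have hunion : #(⋃ Q ∈ F, bad Q) < #(B ⧸ maximalIdeal B) := by
    clear hr hprime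
    induction F, hF using Set.Finite.induction_on with
    | empty => simpa using (aleph0_pos.trans hunc)
    | @insert Q F _ _ ih =>
      rw [Set.biUnion_insert]
      exact (mk_union_le _ _).trans_lt (add_lt_of_lt hunc.le (hlt Q (by simp))
        (ih fun Q' hQ' ↦ hlt Q' (Set.mem_insert_of_mem _ hQ')))
  obtain ⟨x, hx⟩ : ∃ x, x ∉ ⋃ Q ∈ F, bad Q := by
    by_contra! h
    rw [Set.eq_univ_of_forall h, mk_univ] at hunion
    exact hunion.false
  obtain ⟨t, rfl⟩ := Ideal.Quotient.mk_surjective x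
  refine ⟨t, fun Q hQ halg ↦ hx ?_⟩
  exact Set.mem_biUnion hQ ⟨t, rfl, halg⟩

/-- A family indexed by a linear order is algebraically independent if each member is
transcendental over the subalgebra generated by its predecessors. -/
theorem algebraicIndependent_of_transcendental_Iio {ι D : Type*} [LinearOrder ι] [CommRing D]
    [Nontrivial D] [Algebra ℚ D] {v : ι → D}
    (hv : ∀ i, Transcendental (Algebra.adjoin ℚ (v '' Set.Iio i)) (v i)) :
    AlgebraicIndependent ℚ v := by
  refine algebraicIndependent_of_finite_type fun t ht ↦ ?_
  suffices ∀ s : Finset ι, AlgebraicIndepOn ℚ v (s : Set ι) by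
    lift t to Finset ι using ht
    exact this t
  intro s
  induction s using Finset.induction_on_max with
  | empty =>
    rw [Finset.coe_empty]
    exact algebraicIndependent_empty_type_iff.2 (algebraMap ℚ D).injective
  | insert a s hs ih =>
    rw [Finset.coe_insert]
    exact ih.insert ((hv a).of_tower_top_of_subalgebra_le
      (Algebra.adjoin_mono (Set.image_mono fun x hx ↦ hs x hx)))

open Cardinal in
/-- A subalgebra that meets a given finite set of primes trivially and every coset `b + rB`
with `r` outside those primes. -/
theorem exists_subalgebra_meeting_cosets {B : Type*} [CommRing B] [IsLocalRing B] [Algebra ℚ B]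
    (hunc : ℵ₀ < #(B ⧸ maximalIdeal B)) (hcard : #B = #(B ⧸ maximalIdeal B))
    {F : Set (Ideal B)} (hF : F.Finite) (hprime : ∀ Q ∈ F, Q.IsPrime) :
    ∃ A : Subalgebra ℚ B, (∀ Q ∈ F, ∀ a ∈ A, a ∈ Q → a = 0) ∧
      ∀ b r, (∀ Q ∈ F, r ∉ Q) → ∃ t, b + r * t ∈ A := by
  have hB : ℵ₀ < #B := hcard ▸ hunc
  -- Ordering the pairs by an initial ordinal keeps every proper initial segment smaller than `B`.
  obtain ⟨_, _, hord⟩ := exists_ord_eq_type_lt (B × B)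
  have hBB : #(B × B) = #B := by simp [mul_eq_self hB.le]
  have step (i : B × B) (f : ∀ j, j < i → B) : ∃ s : B,
      (∀ Q ∈ F, Transcendental (Algebra.adjoin ℚ
        (Ideal.Quotient.mk Q '' Set.range fun j : Set.Iio i ↦ f j.1 j.2))
        (Ideal.Quotient.mk Q s)) ∧ ((∀ Q ∈ F, i.2 ∉ Q) → ∃ t, s = i.1 + i.2 * t) := by
    have hT : #(Set.range fun j : Set.Iio i ↦ f j.1 j.2) < #(B ⧸ maximalIdeal B) := by
      refine mk_range_le.trans_lt ?_
      rw [← hcard, ← hBB]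
      exact mk_Iio_lt i hord
    by_cases hi : ∀ Q ∈ F, i.2 ∉ Q
    · obtain ⟨t, ht⟩ := exists_transcendental_mod hunc hF hprime hT i.1 hi
      exact ⟨_, ht, fun _ ↦ ⟨t, rfl⟩⟩
    -- Such a pair imposes no coset condition; any transcendental element keeps the recursion total.
    · obtain ⟨t, ht⟩ := exists_transcendental_mod hunc hF hprime hT 0 (r := 1)
        fun Q hQ ↦ (Ideal.ne_top_iff_one Q).1 (hprime Q hQ).ne_top
      exact ⟨_, ht, fun h ↦ (hi h).elim⟩
  choose g hg hg' using step
  set s : B × B → B := WellFoundedLT.fix (fun i f ↦ g i f)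
  have hsi (i) : s i = g i fun j _ ↦ s j := WellFoundedLT.fix_eq _ i
  refine ⟨Algebra.adjoin ℚ (Set.range s), fun Q hQ a ha haQ ↦ ?_, fun b r hr ↦ ?_⟩
  · have := hprime Q hQ
    have hind : AlgebraicIndependent ℚ (Ideal.Quotient.mkₐ ℚ Q ∘ s) := by
      refine algebraicIndependent_of_transcendental_Iio fun i ↦ ?_
      have h := hg i (fun j _ ↦ s j) Q hQ
      rw [← hsi, ← Set.image_eq_range s (Set.Iio i), ← Set.image_comp] at h
      exact h
    rw [Algebra.adjoin_range_eq_range_aeval] at ha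
    obtain ⟨p, rfl⟩ := ha
    have hp : MvPolynomial.aeval (Ideal.Quotient.mkₐ ℚ Q ∘ s) p = 0 := by
      rw [Function.comp_def, ← MvPolynomial.comp_aeval_apply]
      exact Ideal.Quotient.eq_zero_iff_mem.2 haQ
    rw [hind.eq_zero_of_aeval_eq_zero p hp]
    simp
  · obtain ⟨t, ht⟩ := hg' (b, r) (fun j _ ↦ s j) hr
    exact ⟨t, Algebra.subset_adjoin ⟨(b, r), (hsi _).trans ht⟩⟩

/-! ### Comparison of adic completions. -/

theorem AdicCompletion.factorPow_comp_evalₐ {R : Type*} [CommRing R] (I : Ideal R) {m n : ℕ}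
    (hmn : m ≤ n) (x : AdicCompletion I R) :
    Ideal.Quotient.factorPow I hmn (AdicCompletion.evalₐ I n x) = AdicCompletion.evalₐ I m x := by
  induction x using AdicCompletion.induction_on with
  | _ x =>
    rw [AdicCompletion.evalₐ_mk, AdicCompletion.evalₐ_mk]
    exact AdicCompletion.Ideal.mk_eq_mk I hmn x

/-- A ring homomorphism inducing isomorphisms `R ⧸ I ^ n ≃ B ⧸ J ^ n` for all `n` induces
an isomorphism of adic completions. -/
theorem AdicCompletion.exists_ringEquiv_of_quotients {R B : Type*} [CommRing R] [CommRing B]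
    (f : R →+* B) (I : Ideal R) (J : Ideal B) (hcomap : ∀ n, (J ^ n).comap f = I ^ n)
    (happrox : ∀ (n : ℕ) (b : B), ∃ s, f s - b ∈ J ^ n) :
    ∃ e : AdicCompletion I R ≃+* AdicCompletion J B,
      ∀ s, e (AdicCompletion.of I R s) = AdicCompletion.of J B (f s) := by
  have hbij (n) : Function.Bijective (Ideal.quotientMap (J ^ n) f (hcomap n).ge) := by
    refine ⟨Ideal.quotientMap_injective' (hcomap n).le, fun y ↦ ?_⟩
    obtain ⟨b, rfl⟩ := Ideal.Quotient.mk_surjective y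
    obtain ⟨s, hs⟩ := happrox n b
    exact ⟨Ideal.Quotient.mk _ s, by rwa [Ideal.quotientMap_mk, Ideal.Quotient.eq]⟩
  let q (n) : R ⧸ I ^ n ≃+* B ⧸ J ^ n := RingEquiv.ofBijective _ (hbij n)
  have hq_mk (n) (x : R) : q n (Ideal.Quotient.mk _ x) = Ideal.Quotient.mk _ (f x) :=
    Ideal.quotientMap_mk (H := (hcomap n).ge)
  have hq {m n} (hmn : m ≤ n) (x : R ⧸ I ^ n) :
      Ideal.Quotient.factorPow J hmn (q n x) = q m (Ideal.Quotient.factorPow I hmn x) := by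
    obtain ⟨x, rfl⟩ := Ideal.Quotient.mk_surjective x
    rw [hq_mk]
    exact (hq_mk m x).symm
  let φ : AdicCompletion I R →+* AdicCompletion J B := AdicCompletion.liftRingHom J
    (fun n ↦ (q n).toRingHom.comp (AdicCompletion.evalₐ I n).toRingHom) fun {m n} hmn ↦ by
      ext x
      exact (hq hmn _).trans (congrArg (q m) (AdicCompletion.factorPow_comp_evalₐ I hmn x))
  let ψ : AdicCompletion J B →+* AdicCompletion I R := AdicCompletion.liftRingHom I
    (fun n ↦ (q n).symm.toRingHom.comp (AdicCompletion.evalₐ J n).toRingHom) fun {m n} hmn ↦ by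
      ext x
      apply (q m).injective
      refine (hq hmn _).symm.trans ?_
      refine (congrArg _ ((q n).apply_symm_apply _)).trans ?_
      exact (AdicCompletion.factorPow_comp_evalₐ J hmn x).trans ((q m).apply_symm_apply _).symm
  have hφ (n x) : AdicCompletion.evalₐ J n (φ x) = q n (AdicCompletion.evalₐ I n x) :=
    AdicCompletion.evalₐ_liftRingHom _ _ _ _ _
  have hψ (n x) : AdicCompletion.evalₐ I n (ψ x) = (q n).symm (AdicCompletion.evalₐ J n x) :=
    AdicCompletion.evalₐ_liftRingHom _ _ _ _ _
  refine ⟨RingEquiv.ofRingHom φ ψ ?_ ?_, fun s ↦ ?_⟩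
  · ext1 x
    refine AdicCompletion.ext_evalₐ fun n ↦ ?_
    simp [hφ, hψ]
  · ext1 x
    refine AdicCompletion.ext_evalₐ fun n ↦ ?_
    simp [hφ, hψ]
  · refine AdicCompletion.ext_evalₐ fun n ↦ ?_
    rw [AdicCompletion.evalₐ_of]
    refine (hφ n _).trans ?_
    rw [AdicCompletion.evalₐ_of, hq_mk]

/-! ### Consequences of all ideals being contracted. -/

section ContractedIdeals

variable {B : Type*} [CommRing B] {S : Subring B}

theorem Subring.isNoetherianRing_of_comap_map [IsNoetherianRing B]
    (hI : ∀ I : Ideal S, (I.map S.subtype).comap S.subtype = I) : IsNoetherianRing S := by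
  rw [isNoetherianRing_iff, isNoetherian_iff']
  have hmono : StrictMono fun I : Ideal S ↦ I.map S.subtype :=
    Monotone.strictMono_of_injective (fun _ _ h ↦ Ideal.map_mono h)
      (Function.LeftInverse.injective hI)
  exact hmono.wellFoundedGT

theorem Subring.isLocalHom_subtype_of_comap_map
    (hI : ∀ I : Ideal S, (I.map S.subtype).comap S.subtype = I) : IsLocalHom S.subtype := by
  refine ⟨fun s hs ↦ ?_⟩
  rw [← Ideal.span_singleton_eq_top, ← hI (Ideal.span {s}), Ideal.map_span, Set.image_singleton,
    Ideal.span_singleton_eq_top.2 hs, Ideal.comap_top]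

/-- A prime that is contracted from some ideal is contracted from a prime. -/
theorem Subring.surjective_comap_of_comap_map
    (hI : ∀ I : Ideal S, (I.map S.subtype).comap S.subtype = I) :
    Function.Surjective (PrimeSpectrum.comap S.subtype) := by
  intro p
  obtain ⟨q, hq, hqp⟩ := (Ideal.comap_map_eq_self_iff_of_isPrime p.asIdeal).1 (hI p.asIdeal)
  exact ⟨⟨q, hq⟩, PrimeSpectrum.ext hqp⟩

/-- If every ideal of `S` is contracted from `B` and `S` surjects onto every `B ⧸ M ^ n`, then
`S` and `B` have the same completion. -/
theorem Subring.exists_completion_equiv_of_comap_map [IsLocalRing B] [IsNoetherianRing B]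
    [IsLocalRing S] (hI : ∀ I : Ideal S, (I.map S.subtype).comap S.subtype = I)
    (happrox : ∀ (n : ℕ) (b : B), ∃ s : S, (s : B) - b ∈ maximalIdeal B ^ n) :
    ∃ e : AdicCompletion (maximalIdeal S) S ≃+* AdicCompletion (maximalIdeal B) B,
      ∀ s : S, e (AdicCompletion.of (maximalIdeal S) S s) =
        AdicCompletion.of (maximalIdeal B) B (s : B) := by
  have := Subring.isLocalHom_subtype_of_comap_map hI
  have hmap : (maximalIdeal S).map S.subtype = maximalIdeal B := by
    refine le_antisymm (map_maximalIdeal_le _) ?_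
    -- Nakayama: approximation modulo `M ^ 2` gives `M ≤ 𝔪B + M ^ 2`, where `𝔪` is the maximal ideal
    -- of `S`.
    refine Submodule.le_of_le_smul_of_le_jacobson_bot (IsNoetherian.noetherian _)
      (maximalIdeal_le_jacobson ⊥) fun b hb ↦ ?_
    obtain ⟨s, hs⟩ := happrox 2 b
    have hsM : (s : B) ∈ maximalIdeal B := by
      have := Ideal.add_mem _ (Ideal.pow_le_self two_ne_zero hs) hb
      rwa [sub_add_cancel] at this
    rw [← sub_sub_self (s : B) b]
    refine sub_mem (Submodule.mem_sup_left ?_) (Submodule.mem_sup_right ?_)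
    · refine Ideal.mem_map_of_mem S.subtype (x := s) ?_
      rw [← IsLocalRing.maximalIdeal_comap S.subtype]
      exact hsM
    · rwa [smul_eq_mul, ← pow_two]
  refine AdicCompletion.exists_ringEquiv_of_quotients S.subtype _ _ (fun n ↦ ?_) happrox
  rw [← hmap, ← Ideal.map_pow, hI]

end ContractedIdeals

open Cardinal in
theorem Subring.mk_residue_eq {B : Type*} [CommRing B] [IsLocalRing B] {S : Subring B}
    [IsLocalRing S] [IsLocalHom S.subtype] (hcard : #B = #(B ⧸ maximalIdeal B))
    (happrox : ∀ b : B, ∃ s : S, (s : B) - b ∈ maximalIdeal B) :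
    #(S ⧸ maximalIdeal S) = #(B ⧸ maximalIdeal B) ∧ #S = #(S ⧸ maximalIdeal S) := by
  have hcomap := IsLocalRing.maximalIdeal_comap S.subtype
  have hle : #(B ⧸ maximalIdeal B) ≤ #(S ⧸ maximalIdeal S) := by
    refine mk_le_of_surjective
      (f := Ideal.quotientMap (maximalIdeal B) S.subtype hcomap.ge) fun y ↦ ?_
    obtain ⟨b, rfl⟩ := Ideal.Quotient.mk_surjective y
    obtain ⟨s, hs⟩ := happrox b
    exact ⟨Ideal.Quotient.mk _ s, by rwa [Ideal.quotientMap_mk, Ideal.Quotient.eq]⟩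
  have h1 : #(S ⧸ maximalIdeal S) ≤ #S := mk_le_of_surjective Ideal.Quotient.mk_surjective
  have h2 : #S ≤ #B := mk_le_of_injective Subtype.val_injective
  exact ⟨le_antisymm (h1.trans (h2.trans hcard.le)) hle,
    le_antisymm (h2.trans (hcard.le.trans hle)) h1⟩

/-- If `P ∩ S` were minimal, it would lie in `Q ∩ S` for a minimal prime `Q ≤ P`, and extending back
to `B` would give `P ≤ Q`. -/
theorem Subring.height_comap_pos {B : Type*} [CommRing B] {S : Subring B}
    (P : PrimeSpectrum B) (hP : 0 < P.asIdeal.height)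
    (hmap : (PrimeSpectrum.comap S.subtype P).asIdeal.map S.subtype = P.asIdeal) :
    0 < (PrimeSpectrum.comap S.subtype P).asIdeal.height := by
  rw [pos_iff_ne_zero, Ne, Ideal.height_eq_zero_iff] at hP ⊢
  intro hmin
  obtain ⟨Q, hQ, hQP⟩ := Ideal.exists_minimalPrimes_le (bot_le : ⊥ ≤ P.asIdeal)
  have := hQ.1.1
  have hle : (PrimeSpectrum.comap S.subtype P).asIdeal ≤ Q.comap S.subtype :=
    hmin.2 ⟨Ideal.comap_isPrime _ _, bot_le⟩ (Ideal.comap_mono hQP)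
  have hPQ : P.asIdeal ≤ Q := hmap.ge.trans (Ideal.map_le_iff_le_comap.2 hle)
  exact hP (le_antisymm hPQ hQP ▸ hQ)

/-! ### Prime avoidance for minimal primes. -/

section PrimeAvoidance

variable {B : Type*} [CommRing B]

theorem Ideal.exists_mem_notMem_of_finite {F : Set (Ideal B)} (hF : F.Finite)
    (hprime : ∀ Q ∈ F, Q.IsPrime) {I : Ideal B} (hI : ∀ Q ∈ F, ¬ I ≤ Q) :
    ∃ x ∈ I, ∀ Q ∈ F, x ∉ Q := by
  lift F to Finset (Ideal B) using hF
  by_contra! h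
  obtain ⟨Q, hQ, hle⟩ := (Ideal.subset_union_prime (f := id) ⊥ ⊥ fun Q hQ _ _ ↦ hprime Q hQ).1
    (show (I : Set B) ⊆ ⋃ Q ∈ (F : Set (Ideal B)), ((id Q : Ideal B) : Set B) from fun x hx ↦ by
      simpa using h x hx)
  exact hI Q hQ hle

/-- An ideal contained in no minimal prime contains an element outside all minimal primes. -/
theorem Ideal.exists_mem_notMem_minimalPrimes [IsNoetherianRing B] {P : Ideal B} [P.IsPrime]
    (hP : P ∉ minimalPrimes B) : ∃ x ∈ P, ∀ Q ∈ minimalPrimes B, x ∉ Q := by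
  refine Ideal.exists_mem_notMem_of_finite (minimalPrimes.finite_of_isNoetherianRing B)
    (fun Q hQ ↦ hQ.1.1) fun Q hQ hle ↦ hP ?_
  rwa [le_antisymm hle (hQ.2 ⟨‹_›, bot_le⟩ hle)]

/-- For disjoint sets `F`, `G` of minimal primes, some element lies in all members of `F` and in
no member of `G`. -/
theorem exists_mem_notMem_of_disjoint_minimalPrimes [IsNoetherianRing B] {F G : Set (Ideal B)}
    (hF : F ⊆ minimalPrimes B) (hG : G ⊆ minimalPrimes B) (hFG : Disjoint F G) :
    ∃ x, (∀ Q ∈ F, x ∈ Q) ∧ ∀ Q ∈ G, x ∉ Q := by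
  have hfin := minimalPrimes.finite_of_isNoetherianRing B
  obtain ⟨x, hx, hxG⟩ := Ideal.exists_mem_notMem_of_finite (hfin.subset hG)
    (fun Q hQ ↦ (hG hQ).1.1) (I := sInf F) fun Q hQ hle ↦ by
      have := (hG hQ).1.1
      have hF' := hfin.subset hF
      lift F to Finset (Ideal B) using hF'
      rw [← Finset.inf_id_eq_sInf, this.inf_le'] at hle
      obtain ⟨P, hP, hPQ⟩ := hle
      have : P = Q := le_antisymm hPQ ((hG hQ).2 ⟨(hF hP).1.1, bot_le⟩ hPQ)
      exact Set.disjoint_left.1 hFG hP (this ▸ hQ)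
  exact ⟨x, fun Q hQ ↦ Submodule.mem_sInf.1 hx Q hQ, hxG⟩

end PrimeAvoidance

/-! ### The glued ring and its ideals. -/

/-- The elements of `B` that, modulo each `J i`, are fractions of elements of the domain `A`. -/
def Subring.locallyFractions {B ι : Type*} [CommRing B] (A : Subring B) [IsDomain A]
    (J : ι → Ideal B) : Subring B where
  carrier := {b | ∀ i, ∃ a a' : A, a ≠ 0 ∧ a * b - a' ∈ J i}
  mul_mem' {b c} hb hc i := by
    obtain ⟨a, a', ha, h⟩ := hb i
    obtain ⟨d, d', hd, h'⟩ := hc i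
    refine ⟨a * d, a' * d', mul_ne_zero ha hd, ?_⟩
    convert add_mem ((J i).mul_mem_left (d * c) h) ((J i).mul_mem_left (a' : B) h') using 1
    push_cast
    ring
  one_mem' i := ⟨1, 1, one_ne_zero, by simp⟩
  add_mem' {b c} hb hc i := by
    obtain ⟨a, a', ha, h⟩ := hb i
    obtain ⟨d, d', hd, h'⟩ := hc i
    refine ⟨a * d, a' * d + d' * a, mul_ne_zero ha hd, ?_⟩
    convert add_mem ((J i).mul_mem_left (d : B) h) ((J i).mul_mem_left (a : B) h') using 1
    push_cast
    ring
  zero_mem' i := ⟨1, 0, one_ne_zero, by simp⟩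
  neg_mem' {b} hb i := by
    obtain ⟨a, a', ha, h⟩ := hb i
    refine ⟨a, -a', ha, ?_⟩
    convert neg_mem h using 1
    push_cast
    ring

section LocallyFractions

variable {B ι : Type*} [CommRing B] {A : Subring B} [IsDomain A]

theorem Subring.mem_locallyFractions {J : ι → Ideal B} {b : B} :
    b ∈ A.locallyFractions J ↔ ∀ i, ∃ a a' : A, a ≠ 0 ∧ a * b - a' ∈ J i :=
  Iff.rfl

theorem Subring.le_locallyFractions (J : ι → Ideal B) : A ≤ A.locallyFractions J :=
  fun a ha _ ↦ ⟨1, ⟨a, ha⟩, one_ne_zero, by simp⟩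

variable {C : ι → Set (Ideal B)} (hC : ⋃ i, C i = minimalPrimes B)
  (hA : ∀ Q ∈ minimalPrimes B, ∀ a : A, (a : B) ∈ Q → a = 0)

include hC in
theorem mem_minimalPrimes_of_mem_class {i : ι} {Q : Ideal B} (hQ : Q ∈ C i) :
    Q ∈ minimalPrimes B :=
  hC ▸ Set.mem_iUnion_of_mem i hQ

include hC hA

/-- An element of the glued ring lying in one prime of a class lies in all primes of the class. -/
theorem mem_sInf_class_of_mem {b : B} (hb : b ∈ A.locallyFractions fun i ↦ sInf (C i)) {i : ι}
    {Q : Ideal B} (hQ : Q ∈ C i) (hbQ : b ∈ Q) : b ∈ sInf (C i) := by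
  obtain ⟨a, a', ha, h⟩ := Subring.mem_locallyFractions.1 hb i
  have ha' : a' = 0 := by
    refine hA Q (mem_minimalPrimes_of_mem_class hC hQ) a' ?_
    have := sub_mem (Q.mul_mem_left (a : B) hbQ) (Submodule.mem_sInf.1 h Q hQ)
    rwa [sub_sub_cancel] at this
  rw [ha', ZeroMemClass.coe_zero, sub_zero, Submodule.mem_sInf] at h
  refine Submodule.mem_sInf.2 fun P hP ↦ ?_
  have hmin := mem_minimalPrimes_of_mem_class hC hP
  exact (hmin.1.1.mem_or_mem (h P hP)).resolve_left fun haP ↦ ha (hA P hmin a haP)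

theorem mem_locallyFractions_of_mul_mem (hCne : ∀ i, (C i).Nonempty) {a b : B}
    (ha : a ∈ A.locallyFractions fun i ↦ sInf (C i)) (hreg : ∀ Q ∈ minimalPrimes B, a ∉ Q)
    (hab : a * b ∈ A.locallyFractions fun i ↦ sInf (C i)) :
    b ∈ A.locallyFractions fun i ↦ sInf (C i) := by
  intro i
  obtain ⟨c, c', hc, h⟩ := Subring.mem_locallyFractions.1 ha i
  obtain ⟨d, d', hd, h'⟩ := Subring.mem_locallyFractions.1 hab i
  -- From `a = c'/c` and `ab = d'/d` one gets `b = cd'/(dc')`; regularity of `a` makes `c'` nonzero.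
  refine ⟨d * c', c * d', mul_ne_zero hd fun hc' ↦ ?_, ?_⟩
  · obtain ⟨Q, hQ⟩ := hCne i
    have hmin := mem_minimalPrimes_of_mem_class hC hQ
    rw [hc', ZeroMemClass.coe_zero, sub_zero] at h
    exact (hmin.1.1.mem_or_mem (Submodule.mem_sInf.1 h Q hQ)).elim
      (fun hcQ ↦ hc (hA Q hmin c hcQ)) (hreg Q hmin)
  · convert sub_mem ((sInf (C i)).mul_mem_left (c : B) h')
      ((sInf (C i)).mul_mem_left (d * b : B) h) using 1
    push_cast
    ring

variable (hcoset : ∀ b r : B, (∀ Q ∈ minimalPrimes B, r ∉ Q) → ∃ t, b + r * t ∈ A)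

-- For a nonunit `r`, the coset `r + r²B` meets `A` in some `r(1 + rt)`, and `1 + rt` is a unit.
omit [IsDomain A] hC hA in
include hcoset in
theorem exists_isUnit_mul_mem [IsLocalRing B] {r : B} (hr : ∀ Q ∈ minimalPrimes B, r ∉ Q) :
    ∃ u, IsUnit u ∧ r * u ∈ A := by
  by_cases hu : IsUnit r
  · obtain ⟨v, hv⟩ := hu.exists_right_inv
    exact ⟨v, .of_mul_eq_one r (by rw [mul_comm, hv]), hv ▸ one_mem A⟩
  · obtain ⟨t, ht⟩ := hcoset r (r * r) fun Q hQ h ↦ (hQ.1.1.mem_or_mem h).elim (hr Q hQ) (hr Q hQ)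
    refine ⟨1 + r * t, ?_, by convert ht using 1; ring⟩
    by_contra h
    refine (maximalIdeal.isMaximal B).ne_top ((Ideal.eq_top_iff_one _).2 ?_)
    rw [← add_sub_cancel_right 1 (r * t)]
    exact sub_mem h (Ideal.mul_mem_right _ _ hu)

include hcoset

omit hA in
/-- The glued ring separates the classes. -/
theorem exists_mem_locallyFractions_separating [IsLocalRing B] [IsNoetherianRing B]
    (hCdisj : Pairwise fun i j ↦ Disjoint (C i) (C j)) (G : Set ι) :
    ∃ x ∈ A.locallyFractions fun i ↦ sInf (C i), (∀ i ∉ G, ∀ Q ∈ C i, x ∈ Q) ∧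
      ∀ i ∈ G, ∀ Q ∈ C i, x ∉ Q := by
  have hsub (H : Set ι) : ⋃ i ∈ H, C i ⊆ minimalPrimes B :=
    Set.iUnion₂_subset fun i _ ↦ hC ▸ Set.subset_iUnion C i
  have hdisj : Disjoint (⋃ i ∈ Gᶜ, C i) (⋃ i ∈ G, C i) := by
    simp only [Set.disjoint_iUnion_left, Set.disjoint_iUnion_right]
    rintro i hi j hj
    refine hCdisj ?_
    rintro rfl
    contradiction
  obtain ⟨x, hx, hx'⟩ := exists_mem_notMem_of_disjoint_minimalPrimes (hsub _) (hsub _) hdisj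
  obtain ⟨y, hy, hy'⟩ := exists_mem_notMem_of_disjoint_minimalPrimes (hsub _) (hsub _) hdisj.symm
  simp only [Set.mem_iUnion, forall_exists_index, exists_prop, and_imp] at hx hx' hy hy'
  have hreg : ∀ Q ∈ minimalPrimes B, x + y ∉ Q := by
    intro Q hQ h
    rw [← hC] at hQ
    obtain ⟨i, hi⟩ := Set.mem_iUnion.1 hQ
    by_cases hG : i ∈ G
    · exact hx' Q i hG hi ((Submodule.add_mem_iff_left _ (hy Q i hG hi)).1 h)
    · exact hy' Q i hG hi ((Submodule.add_mem_iff_right _ (hx Q i hG hi)).1 h)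
  -- Then `xu` is congruent to `(x + y)u ∈ A` at the classes in `G` and to `0` at the others.
  obtain ⟨u, hu, hmem⟩ := exists_isUnit_mul_mem hcoset hreg
  refine ⟨x * u, fun i ↦ ?_, fun i hi Q hQ ↦ Q.mul_mem_right _ (hx Q i hi hQ), fun i hi Q hQ h ↦ ?_⟩
  · by_cases hG : i ∈ G
    · refine ⟨1, ⟨_, hmem⟩, one_ne_zero, Submodule.mem_sInf.2 fun Q hQ ↦ ?_⟩
      convert Ideal.mul_mem_right (-u) Q (hy Q i hG hQ) using 1
      push_cast
      ring
    · refine ⟨1, 0, one_ne_zero, Submodule.mem_sInf.2 fun Q hQ ↦ ?_⟩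
      convert Ideal.mul_mem_right u Q (hx Q i hG hQ) using 1
      push_cast
      ring
  · have := (mem_minimalPrimes_of_mem_class hC hQ).1.1
    exact hx' Q i hi hQ ((Ideal.mul_unit_mem_iff_mem _ hu).1 h)

/-- An ideal of the glued ring containing a regular element is contracted from `B`. -/
theorem mem_of_mem_map_of_regular_mem (hCne : ∀ i, (C i).Nonempty)
    {I : Ideal (A.locallyFractions fun i ↦ sInf (C i))}
    {a : A.locallyFractions fun i ↦ sInf (C i)} (haI : a ∈ I)
    (hreg : ∀ Q ∈ minimalPrimes B, (a : B) ∉ Q)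
    {c : A.locallyFractions fun i ↦ sInf (C i)}
    (hc : (c : B) ∈ I.map (Subring.subtype (A.locallyFractions fun i ↦ sInf (C i)))) :
    c ∈ I := by
  have key : ∀ c ∈ I.map (Subring.subtype (A.locallyFractions fun i ↦ sInf (C i))), ∃ w ∈ I, ∃ b, c = w + a * b := by
    intro c hc
    induction hc using Submodule.span_induction with
    | mem c hc =>
      obtain ⟨w, hw, rfl⟩ := hc
      exact ⟨w, hw, 0, by simp⟩
    | zero => exact ⟨0, zero_mem _, 0, by simp⟩
    | add c d _ _ hc hd =>
      obtain ⟨w, hw, b, rfl⟩ := hc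
      obtain ⟨v, hv, b', rfl⟩ := hd
      exact ⟨w + v, add_mem hw hv, b + b', by push_cast; ring⟩
    | smul r c _ hc =>
      obtain ⟨w, hw, b, rfl⟩ := hc
      obtain ⟨t, ht⟩ := hcoset r a hreg
      -- `r` is replaced by `r + at ∈ A`; the error is a multiple of `a`.
      refine ⟨⟨_, Subring.le_locallyFractions _ ht⟩ * w, I.mul_mem_left _ hw, r * b - t * w, ?_⟩
      push_cast
      rw [smul_eq_mul]
      ring
  obtain ⟨w, hw, b, hcw⟩ := key c hc
  have hb : b ∈ A.locallyFractions fun i ↦ sInf (C i) := by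
    refine mem_locallyFractions_of_mul_mem hC hA hCne a.2 hreg ?_
    rw [← sub_eq_of_eq_add' hcw]
    exact sub_mem c.2 w.2
  have : c = w + a * ⟨b, hb⟩ := Subtype.ext hcw
  exact this ▸ add_mem hw (I.mul_mem_right _ haI)

/-- `I` may lack a regular element. With `G` the classes where `IB` vanishes, some `a ∈ I` avoids
the primes of the other classes, and a separating `x` vanishes exactly off `G`, so `a + x` is
regular. The regular case for `I + (x)` writes `c = w + sx`. Here `sx ∈ IB` vanishes on `G` and `x`
vanishes off it, so `sx = 0` as `B` is reduced. -/
theorem comap_map_locallyFractions [IsLocalRing B] [IsNoetherianRing B] [IsReduced B]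
    (hCne : ∀ i, (C i).Nonempty) (hCdisj : Pairwise fun i j ↦ Disjoint (C i) (C j))
    (I : Ideal (A.locallyFractions fun i ↦ sInf (C i))) :
    (I.map (Subring.subtype (A.locallyFractions fun i ↦ sInf (C i)))).comap
      (Subring.subtype (A.locallyFractions fun i ↦ sInf (C i))) = I := by
  refine le_antisymm (fun c hc ↦ ?_) Ideal.le_comap_map
  let G : Set ι :=
    {i | I.map (Subring.subtype (A.locallyFractions fun i ↦ sInf (C i))) ≤ sInf (C i)}
  obtain ⟨x, hxS, hx, hx'⟩ := exists_mem_locallyFractions_separating hC hcoset hCdisj G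
  have hfin := minimalPrimes.finite_of_isNoetherianRing B
  have hF : (⋃ i ∈ Gᶜ, C i).Finite :=
    hfin.subset (Set.iUnion₂_subset fun i _ ↦ hC ▸ Set.subset_iUnion C i)
  obtain ⟨a, haI, ha⟩ := Ideal.exists_mem_notMem_of_finite
    (hF.image (Ideal.comap (Subring.subtype (A.locallyFractions fun i ↦ sInf (C i)))))
    (I := I) (by
      rintro _ ⟨Q, hQ, rfl⟩
      obtain ⟨i, -, hi⟩ := Set.mem_iUnion₂.1 hQ
      have := (mem_minimalPrimes_of_mem_class hC hi).1.1
      exact Ideal.comap_isPrime _ _) (by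
      rintro _ ⟨Q, hQ, rfl⟩ hle
      obtain ⟨i, hiG, hi⟩ := Set.mem_iUnion₂.1 hQ
      refine hiG (Ideal.map_le_iff_le_comap.2 fun s hs ↦ ?_)
      exact mem_sInf_class_of_mem hC hA s.2 hi (hle hs))
  have haQ : ∀ i ∉ G, ∀ Q ∈ C i, (a : B) ∉ Q := fun i hi Q hQ h ↦
    ha _ ⟨Q, Set.mem_iUnion₂.2 ⟨i, hi, hQ⟩, rfl⟩ h
  have hIG : ∀ i ∈ G, ∀ Q ∈ C i,
      ∀ b ∈ I.map (Subring.subtype (A.locallyFractions fun i ↦ sInf (C i))), b ∈ Q := fun i hi Q hQ b hb ↦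
    Submodule.mem_sInf.1 (hi hb) Q hQ
  have hreg : ∀ Q ∈ minimalPrimes B, ((a + ⟨x, hxS⟩ : A.locallyFractions _) : B) ∉ Q := by
    intro Q hQ h
    rw [← hC] at hQ
    obtain ⟨i, hi⟩ := Set.mem_iUnion.1 hQ
    by_cases hiG : i ∈ G
    · exact hx' i hiG Q hi ((Submodule.add_mem_iff_right _
        (hIG i hiG Q hi _ (Ideal.mem_map_of_mem _ haI))).1 h)
    · exact haQ i hiG Q hi ((Submodule.add_mem_iff_left _ (hx i hiG Q hi)).1 h)
  have hcI : c ∈ I ⊔ Ideal.span {⟨x, hxS⟩} :=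
    mem_of_mem_map_of_regular_mem hC hA hcoset hCne
      (add_mem (Ideal.mem_sup_left haI)
        (Ideal.mem_sup_right (Ideal.mem_span_singleton_self _))) hreg
      (Ideal.map_mono le_sup_left hc)
  obtain ⟨w, hw, z, hz, rfl⟩ := Submodule.mem_sup.1 hcI
  obtain ⟨s, rfl⟩ := Ideal.mem_span_singleton'.1 hz
  suffices h : (s * ⟨x, hxS⟩ : A.locallyFractions _) = 0 by
    rw [h, add_zero]
    exact hw
  have hxs : (s : B) * x ∈ I.map (Subring.subtype (A.locallyFractions fun i ↦ sInf (C i))) :=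
    (Submodule.add_mem_iff_right _ (Ideal.mem_map_of_mem (Subring.subtype _) hw)).1 hc
  refine Subtype.ext (show (s : B) * x = 0 from ?_)
  have hnil : nilradical B = ⊥ := nilradical_eq_zero B
  rw [← Ideal.mem_bot, ← hnil, nilradical, ← Ideal.sInf_minimalPrimes]
  refine Submodule.mem_sInf.2 fun Q hQ ↦ ?_
  obtain ⟨i, hi⟩ := Set.mem_iUnion.1 (hC.ge hQ)
  by_cases hiG : i ∈ G
  · exact hIG i hiG Q hi _ hxs
  · exact Ideal.mul_mem_left Q _ (hx i hiG Q hi)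

end LocallyFractions

/-! ### Contraction of primes to the glued ring. -/

section LocallyFractions

variable {B ι : Type*} [CommRing B] {A : Subring B} [IsDomain A]

/-- Modulo a regular element of the glued ring, every element of `B` is congruent to an element of
the glued ring; hence every prime with a regular element is generated by its contraction. -/
theorem map_comap_locallyFractions [IsLocalRing B] [IsNoetherianRing B] (J : ι → Ideal B)
    (hcoset : ∀ b r : B, (∀ Q ∈ minimalPrimes B, r ∉ Q) → ∃ t, b + r * t ∈ A)
    {P : Ideal B} [P.IsPrime] (hP : P ∉ minimalPrimes B) :
    (P.comap (A.locallyFractions J).subtype).map (A.locallyFractions J).subtype = P := by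
  refine le_antisymm Ideal.map_comap_le fun p hp ↦ ?_
  have key : ∀ q ∈ P, q ∈ A →
      q ∈ (P.comap (A.locallyFractions J).subtype).map (A.locallyFractions J).subtype :=
    fun q hqP hqA ↦ Ideal.mem_map_of_mem (A.locallyFractions J).subtype
      (x := ⟨q, Subring.le_locallyFractions J hqA⟩) hqP
  obtain ⟨r, hrP, hr⟩ := Ideal.exists_mem_notMem_minimalPrimes hP
  obtain ⟨u, hu, hru⟩ := exists_isUnit_mul_mem hcoset hr
  obtain ⟨t, ht⟩ := hcoset p (r * u) fun Q hQ h ↦ by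
    have := hQ.1.1
    exact hr Q hQ ((Ideal.mul_unit_mem_iff_mem _ hu).1 h)
  have hruP : r * u ∈ P := P.mul_mem_right u hrP
  rw [← add_sub_cancel_right p (r * u * t)]
  exact sub_mem (key _ (add_mem hp (P.mul_mem_right t hruP)) ht)
    (Ideal.mul_mem_right t _ (key _ hruP hru))

theorem comap_locallyFractions_eq_iff [IsLocalRing B] [IsNoetherianRing B] {C : ι → Set (Ideal B)}
    (hC : ⋃ i, C i = minimalPrimes B) (hCdisj : Pairwise fun i j ↦ Disjoint (C i) (C j))
    (hA : ∀ Q ∈ minimalPrimes B, ∀ a : A, (a : B) ∈ Q → a = 0)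
    (hcoset : ∀ b r : B, (∀ Q ∈ minimalPrimes B, r ∉ Q) → ∃ t, b + r * t ∈ A)
    {Q Q' : Ideal B} (hQ : Q ∈ minimalPrimes B) (hQ' : Q' ∈ minimalPrimes B) :
    Q.comap (A.locallyFractions fun i ↦ sInf (C i)).subtype =
      Q'.comap (A.locallyFractions fun i ↦ sInf (C i)).subtype ↔ ∃ i, Q ∈ C i ∧ Q' ∈ C i := by
  refine ⟨fun h ↦ ?_, fun ⟨i, hi, hi'⟩ ↦ Ideal.ext fun s ↦ ⟨fun hs ↦ ?_, fun hs ↦ ?_⟩⟩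
  · rw [← hC] at hQ hQ'
    obtain ⟨i, hi⟩ := Set.mem_iUnion.1 hQ
    obtain ⟨j, hj⟩ := Set.mem_iUnion.1 hQ'
    obtain ⟨x, hxS, hx, hx'⟩ := exists_mem_locallyFractions_separating hC hcoset hCdisj {i}
    by_cases hij : j = i
    · exact ⟨i, hi, hij ▸ hj⟩
    · have hmem : (⟨x, hxS⟩ : A.locallyFractions fun i ↦ sInf (C i)) ∈
          Q'.comap (A.locallyFractions fun i ↦ sInf (C i)).subtype := hx j hij Q' hj
      rw [← h] at hmem
      exact (hx' i rfl Q hi hmem).elim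
  · exact Submodule.mem_sInf.1 (mem_sInf_class_of_mem hC hA s.2 hi hs) _ hi'
  · exact Submodule.mem_sInf.1 (mem_sInf_class_of_mem hC hA s.2 hi' hs) _ hi

end LocallyFractions

/-! ### The gluing theorem. -/

theorem theorem2p10 {B : Type*} [CommRing B] [IsLocalRing B] [IsNoetherianRing B] [IsReduced B]
    [Algebra ℚ B]
    (hunc : Uncountable (B ⧸ maximalIdeal B))
    (hcard : Cardinal.mk B = Cardinal.mk (B ⧸ maximalIdeal B))
    (m : ℕ) (hm : 1 ≤ m) (C : Fin m → Set (Ideal B))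
    (hCne : ∀ i, (C i).Nonempty)
    (hCdisj : Pairwise fun i j => Disjoint (C i) (C j))
    (hCunion : ⋃ i, C i = minimalPrimes B) :
    ∃ (S : Subring B) (_ : IsLocalRing S),
      -- `S` is a reduced local (Noetherian) ring with maximal ideal `S ∩ M`
      IsNoetherianRing S ∧ IsReduced S ∧
      maximalIdeal S = (maximalIdeal B).comap S.subtype ∧
      -- `S` contains the rationals
      (∀ q : ℚ, algebraMap ℚ B q ∈ S) ∧
      -- the completions agree, compatibly with the inclusion of `S` in `B`
      (∃ e : AdicCompletion (maximalIdeal S) S ≃+* AdicCompletion (maximalIdeal B) B,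
        ∀ s : S, e (AdicCompletion.of (maximalIdeal S) S s) =
          AdicCompletion.of (maximalIdeal B) B (s : B)) ∧
      -- the residue field of `S`
      Uncountable (S ⧸ maximalIdeal S) ∧
      Cardinal.mk S = Cardinal.mk (S ⧸ maximalIdeal S) ∧
      -- gluing of the minimal primes
      (∀ Q ∈ minimalPrimes B, ∀ Q' ∈ minimalPrimes B,
        (Q.comap S.subtype = Q'.comap S.subtype ↔ ∃ i, Q ∈ C i ∧ Q' ∈ C i)) ∧
      -- the contraction map on spectra
      Function.Surjective (PrimeSpectrum.comap S.subtype) ∧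
      (∀ P : PrimeSpectrum B, 0 < P.asIdeal.height →
        (PrimeSpectrum.comap S.subtype P).asIdeal.map S.subtype = P.asIdeal) ∧
      (∀ P : PrimeSpectrum B, 0 < P.asIdeal.height →
        0 < (PrimeSpectrum.comap S.subtype P).asIdeal.height) ∧
      (∀ P P' : PrimeSpectrum B, 0 < P.asIdeal.height → 0 < P'.asIdeal.height →
        PrimeSpectrum.comap S.subtype P = PrimeSpectrum.comap S.subtype P' → P = P') := by
  suffices h : ∃ S : Subring B,
      (∀ I : Ideal S, (I.map S.subtype).comap S.subtype = I) ∧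
      (∀ (n : ℕ) (b : B), ∃ s : S, (s : B) - b ∈ maximalIdeal B ^ n) ∧
      (∀ q : ℚ, algebraMap ℚ B q ∈ S) ∧
      (∀ Q ∈ minimalPrimes B, ∀ Q' ∈ minimalPrimes B,
        (Q.comap S.subtype = Q'.comap S.subtype ↔ ∃ i, Q ∈ C i ∧ Q' ∈ C i)) ∧
      ∀ P : PrimeSpectrum B, 0 < P.asIdeal.height →
        (PrimeSpectrum.comap S.subtype P).asIdeal.map S.subtype = P.asIdeal by
    obtain ⟨S, hI, happrox, hQ, hglue, hP⟩ := h
    have hloc := Subring.isLocalHom_subtype_of_comap_map hI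
    have hS : IsLocalRing S := S.subtype.domain_isLocalRing
    obtain ⟨hres, hres'⟩ := Subring.mk_residue_eq (S := S) hcard
      fun b ↦ by simpa using happrox 1 b
    refine ⟨S, hS, Subring.isNoetherianRing_of_comap_map hI,
      isReduced_of_injective S.subtype Subtype.val_injective,
      (IsLocalRing.maximalIdeal_comap S.subtype).symm, hQ,
      Subring.exists_completion_equiv_of_comap_map hI happrox, ?_, hres', hglue,
      Subring.surjective_comap_of_comap_map hI, hP,
      fun P h ↦ Subring.height_comap_pos P h (hP P h), fun P P' h h' hPP' ↦ ?_⟩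
    · rwa [← Cardinal.aleph0_lt_mk_iff, hres, Cardinal.aleph0_lt_mk_iff]
    · exact PrimeSpectrum.ext (by rw [← hP P h, ← hP P' h', hPP'])
  -- If `M` is minimal it is the only prime, nothing needs gluing, and `S = B` works. Otherwise `M`
  -- contains an `r` outside all minimal primes, and the cosets `b + r ^ n B` give density.
  by_cases hM : maximalIdeal B ∈ minimalPrimes B
  · have hbij : Function.Bijective (⊤ : Subring B).subtype :=
      ⟨Subtype.val_injective, fun b ↦ ⟨⟨b, trivial⟩, rfl⟩⟩
    have heq : ∀ Q ∈ minimalPrimes B, Q = maximalIdeal B := fun Q hQ ↦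
      have hle := le_maximalIdeal hQ.1.1.ne_top
      le_antisymm hle (hM.2 hQ.1 hle)
    refine ⟨⊤, fun I ↦ Ideal.comap_map_of_bijective _ hbij,
      fun n b ↦ ⟨⟨b, trivial⟩, by simp⟩, fun q ↦ trivial, fun Q hQ Q' hQ' ↦ ?_,
      fun P _ ↦ Ideal.map_comap_of_surjective _ hbij.2 _⟩
    rw [heq Q hQ, heq Q' hQ']
    rw [← hCunion] at hM
    obtain ⟨i, hi⟩ := Set.mem_iUnion.1 hM
    exact ⟨fun _ ↦ ⟨i, hi, hi⟩, fun _ ↦ rfl⟩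
  · obtain ⟨A, hA, hcoset⟩ := exists_subalgebra_meeting_cosets (Cardinal.aleph0_lt_mk_iff.2 hunc)
      hcard (minimalPrimes.finite_of_isNoetherianRing B) fun Q hQ ↦ hQ.1.1
    replace hA : ∀ Q ∈ minimalPrimes B, ∀ a : A.toSubring, (a : B) ∈ Q → a = 0 :=
      fun Q hQ a ha ↦ Subtype.ext (hA Q hQ a a.2 ha)
    have hdom : IsDomain A.toSubring := by
      obtain ⟨Q, hQ⟩ := Ideal.nonempty_minimalPrimes (bot_ne_top (α := Ideal B))
      have := hQ.1.1
      have hnzd : NoZeroDivisors A.toSubring := ⟨fun {a b} hab ↦ by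
        have h : (a : B) * b ∈ Q := by
          rw [← Subring.coe_mul, hab]
          exact zero_mem Q
        exact (this.mem_or_mem h).imp (hA Q hQ a) (hA Q hQ b)⟩
      exact NoZeroDivisors.to_isDomain _
    refine ⟨A.toSubring.locallyFractions fun i ↦ sInf (C i),
      comap_map_locallyFractions hCunion hA hcoset hCne hCdisj, fun n b ↦ ?_,
      fun q ↦ Subring.le_locallyFractions _ (A.algebraMap_mem q),
      fun Q hQ Q' hQ' ↦ comap_locallyFractions_eq_iff hCunion hCdisj hA hcoset hQ hQ',
      fun P hP ↦ map_comap_locallyFractions _ hcoset fun h ↦ ?_⟩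
    · obtain ⟨r, hrM, hr⟩ := Ideal.exists_mem_notMem_minimalPrimes hM
      obtain ⟨t, ht⟩ := hcoset b (r ^ n) fun Q hQ h ↦ hr Q hQ (hQ.1.1.mem_of_pow_mem n h)
      refine ⟨⟨_, Subring.le_locallyFractions _ ht⟩, ?_⟩
      rw [add_sub_cancel_left]
      exact Ideal.mul_mem_right _ _ (Ideal.pow_mem_pow hrM n)
    · exact hP.ne' (Ideal.height_eq_zero_iff.2 h)
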